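/- Let $A\in\mathbb R^{d_x\times d_x}$, $B\in\mathbb R^{d_x\times d_w}$, $C_y\in\mathbb R^{d_y\times d_x}$, $C_s\in\mathbb R^{d_s\times d_x}$ and let $T\ge 1$ be a horizon. Consider the state-space model $x_{t+1}=Ax_t+Bw_t$, $y_t=C_yx_t+v_t$, $s_t=C_sx_t$, and stack $\mathbf w_T=[x_0;w_0;\dots;w_{T-2}]$, $\mathbf v_T=[v_0;\dots;v_{T-1}]$, $\mathbf y_T=[y_0;\dots;y_{T-1}]$, $\mathbf s_T=[s_0;\dots;s_{T-1}]$, so that $\mathbf y_T=\mathcal H_T\mathbf w_T+\mathbf v_T$ and $\mathbf s_T=\mathcal L_T\mathbf w_T$ with block lower-triangular matrices $\mathcal H_T,\mathcal L_T$: in block row $t$, the block of $\mathcal H_T$ multiplying $x_0$ is $C_yA^t$, the block multiplying $w_k$ is $C_yA^{t-k-1}B$ for $k<t$ and $0$ for $k\ge t$; $\mathcal L_T$ is the same with $C_s$ in place of $C_y$. Let $\boldsymbol\xi_T=[\mathbf w_T;\mathbf v_T]\in\Xi_T=\mathbb R^{d_x+(T-1)d_w+Td_y}$, and let $\mathbb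 P_T^\circ$ be a nominal probability distribution on $\Xi_T$ with finite second moment and $\mathbb E_{\mathbb P_T^\circ}[\boldsymbol\xi_T\boldsymbol\xi_T^{*}]=I$ (for zero-mean disturbances, identity covariance). For $\rho_T\ge 0$ and a linear, possibly non-causal estimator $\widehat{\mathbf s}_T=K\mathbf y_T$ with $K\in\mathbb R^{Td_s\times Td_y}$, define the worst-case mean-squared error $$\mathsf E_T(K,\rho_T)=\sup\bigl\{\mathbb E_{\mathbb P}\|K\mathbf y_T-\mathbf s_T\|^2 \;:\; \mathbb P \text{ a probability distribution on } \Xi_T \text{ with finite second moment, } \mathsf W_2(\mathbb P,\mathbb P_T^\circ)\le\rho_T\bigr\},$$ where $\mathsf W_2(\mathbb P_1,\mathbb P_2)=\bigl(\inf \mathbb E\|\boldsymbol\xi_1-\boldsymbol\xi_2\|^2\bigr)^{1/2}$, the infimum being over all joint distributions of $(\boldsymbol\xi_1,\boldsymbol\xi_2)$ with marginals $\mathbb P_1,\mathbb P_2$, and $\|\cdot\|$ is the Euclidean norm. Then, for every $\rho_T\ge 0$, $$K_T^\circ=\mathcal L_T\mathcal H_T^{*}\,(I+\mathcal H_T\mathcal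 H_T^{*})^{-1}$$ is the unique minimizer of $K\mapsto\mathsf E_T(K,\rho_T)$ over all matrices $K\in\mathbb R^{Td_s\times Td_y}$. -/

import Mathlib

open MeasureTheory
open scoped ENNReal Matrix

noncomputable section

namespace DRKF

/-- Index set of the coordinates of the process-noise vector `w = [x₀; w₀; …; w_{T-2}]`. -/
abbrev ProcIdx (dx dw T : ℕ) : Type := Fin dx ⊕ (Fin (T - 1) × Fin dw)

/-- Index set of the coordinates of a signal `[z₀; …; z_{T-1}]` with `z_t ∈ ℝ^d`. -/
abbrev SigIdx (d T : ℕ) : Type := Fin T × Fin d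

/-- The space `Ξ_T` of combined disturbances `ξ = [w; v]`, with the Euclidean norm. -/
abbrev Disturbance (dx dw dy T : ℕ) : Type :=
  EuclideanSpace ℝ (ProcIdx dx dw T ⊕ SigIdx dy T)

/-- The block lower-triangular matrix mapping `[x₀; w₀; …; w_{T-2}]` to the stacked outputs
`[C x₀; …; C x_{T-1}]` of the recursion `x_{t+1} = A x_t + B w_t`. Block row `t` is
`C A^t` in the column of `x₀`, `C A^(t-k-1) B` in the column of `w_k` for `k < t`,
and `0` in the column of `w_k` for `k ≥ t`. -/
def outputMatrix {dx dw d : ℕ} (A : Matrix (Fin dx) (Fin dx) ℝ) (B : Matrix (Fin dx) (Fin dw) ℝ)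
    (C : Matrix (Fin d) (Fin dx) ℝ) (T : ℕ) : Matrix (SigIdx d T) (ProcIdx dx dw T) ℝ :=
  Matrix.of fun r c =>
    match c with
    | Sum.inl a => (C * A ^ (r.1 : ℕ)) r.2 a
    | Sum.inr k =>
        if (k.1 : ℕ) < (r.1 : ℕ) then (C * A ^ ((r.1 : ℕ) - (k.1 : ℕ) - 1) * B) r.2 k.2 else 0

/-- The stacked measurements `y = H w + v`. -/
def measurement {dx dw dy T : ℕ} (H : Matrix (SigIdx dy T) (ProcIdx dx dw T) ℝ)
    (ξ : Disturbance dx dw dy T) : SigIdx dy T → ℝ :=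
  H *ᵥ (fun j => ξ (Sum.inl j)) + fun i => ξ (Sum.inr i)

/-- The stacked target signal `s = L w`. -/
def target {dx dw dy ds T : ℕ} (L : Matrix (SigIdx ds T) (ProcIdx dx dw T) ℝ)
    (ξ : Disturbance dx dw dy T) : SigIdx ds T → ℝ :=
  L *ᵥ fun j => ξ (Sum.inl j)

/-- The estimation error `e = ŝ - s` of the linear estimator `ŝ = K y`, a Euclidean vector. -/
def estError {dx dw dy ds T : ℕ} (H : Matrix (SigIdx dy T) (ProcIdx dx dw T) ℝ)
    (L : Matrix (SigIdx ds T) (ProcIdx dx dw T) ℝ) (K : Matrix (SigIdx ds T) (SigIdx dy T) ℝ)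
    (ξ : Disturbance dx dw dy T) : EuclideanSpace ℝ (SigIdx ds T) :=
  WithLp.toLp 2 (K *ᵥ measurement H ξ - target L ξ)

/-- Probability distributions with finite second moment. -/
def IsProb2 {E : Type*} [NormedAddCommGroup E] [MeasurableSpace E] (P : Measure E) : Prop :=
  IsProbabilityMeasure P ∧ MemLp (fun x : E => x) 2 P

/-- The Wasserstein-2 distance: the square root of the infimum of `𝔼 ‖w₁ - w₂‖²` over all
joint distributions with the given marginals. -/
def W2 {E : Type*} [NormedAddCommGroup E] [MeasurableSpace E] (P Q : Measure E) : ℝ≥0∞ :=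
  (⨅ (π : Measure (E × E)) (_ : π.map Prod.fst = P ∧ π.map Prod.snd = Q),
    ∫⁻ p, ‖p.1 - p.2‖ₑ ^ 2 ∂π) ^ (1 / 2 : ℝ)

/-- The Wasserstein-2 ambiguity ball of radius `ρ` around `P₀`. -/
def ambiguityBall {E : Type*} [NormedAddCommGroup E] [MeasurableSpace E]
    (P₀ : Measure E) (ρ : ℝ) : Set (Measure E) :=
  {P | IsProb2 P ∧ W2 P P₀ ≤ ENNReal.ofReal ρ}

/-- The matrix of second moments `𝔼[ξ ξᵀ]`. -/
def secondMoment {ι : Type*} (P : Measure (EuclideanSpace ℝ ι)) : Matrix ι ι ℝ :=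
  Matrix.of fun i j => ∫ ξ, ξ i * ξ j ∂P

/-- The worst-case mean-squared error of the estimator `K` over the ambiguity ball, as an
extended nonnegative real number. -/
def worstCaseMSE {dx dw dy ds T : ℕ} (H : Matrix (SigIdx dy T) (ProcIdx dx dw T) ℝ)
    (L : Matrix (SigIdx ds T) (ProcIdx dx dw T) ℝ) (P₀ : Measure (Disturbance dx dw dy T))
    (ρ : ℝ) (K : Matrix (SigIdx ds T) (SigIdx dy T) ℝ) : ℝ≥0∞ :=
  ⨆ P ∈ ambiguityBall P₀ ρ, ∫⁻ ξ, ‖estError H L K ξ‖ₑ ^ 2 ∂P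

/-- The nominal non-causal estimator `K° = L H* (I + H H*)⁻¹`. -/
def nonCausalEstimator {dx dw dy ds T : ℕ} (H : Matrix (SigIdx dy T) (ProcIdx dx dw T) ℝ)
    (L : Matrix (SigIdx ds T) (ProcIdx dx dw T) ℝ) : Matrix (SigIdx ds T) (SigIdx dy T) ℝ :=
  L * Hᵀ * (1 + H * Hᵀ)⁻¹

end DRKF

end

/-! The error of `K` is a linear map `T_K = [KH - L, K]` of the disturbance, and `T_K = T + R` with
`T` the error map of `K°` and `R = (K - K°)[H, I]`. The normal equations `K°(I + HH*) = LH*` say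
that `T` kills the range of `[H, I]*`; hence `R` vanishes on `(ker T)ᗮ`, and every right singular
vector `v i` of `T` lies in `ker T` or in `ker R`.

Since the nominal law is isotropic, the adversary against `T` can do no better than stretch each `v
i` by `1 + j i` with `∑ j i² ≤ ρ²`, up to an arbitrarily small excess
(`exists_stretch_of_coupling`). Conversely such stretches are available against every linear map
(`le_iSup_of_stretch`). The same stretch used against `T + R` keeps all of the `T` terms and adds
`‖R (v i)‖²` in the kernel directions. So the worst-case error grows by at least the squared
Hilbert–Schmidt norm of `R` (`exists_iSup_add_le`). This gives optimality; as the worst case is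
finite and `[H, I]` is onto, it also gives uniqueness. -/

namespace DRKF

open scoped InnerProductSpace

/-! ### Singular bases and Parseval identities. -/

section Linear

variable {E F ι : Type*} [NormedAddCommGroup E] [InnerProductSpace ℝ E] [NormedAddCommGroup F]
  [InnerProductSpace ℝ F] [Fintype ι]

/-- A linear map admits an orthonormal basis of right singular vectors. -/
lemma exists_orthonormalBasis_inner_map_eq_zero [FiniteDimensional ℝ E] [FiniteDimensional ℝ F]
    (T : E →ₗ[ℝ] F) :
    ∃ v : OrthonormalBasis (Fin (Module.finrank ℝ E)) ℝ E,
      ∀ i j, i ≠ j → ⟪T (v i), T (v j)⟫_ℝ = 0 := by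
  have hS : (T.adjoint ∘ₗ T).IsSymmetric := fun x y => by
    simp [LinearMap.adjoint_inner_left, LinearMap.adjoint_inner_right]
  refine ⟨hS.eigenvectorBasis rfl, fun i j hij => ?_⟩
  rw [← LinearMap.adjoint_inner_right, ← LinearMap.comp_apply, hS.apply_eigenvectorBasis,
    inner_smul_right, (hS.eigenvectorBasis rfl).inner_eq_zero hij, mul_zero]

lemma map_eq_sum_inner_smul (v : OrthonormalBasis ι ℝ E) (T : E →ₗ[ℝ] F) (x : E) :
    T x = ∑ i, ⟪v i, x⟫_ℝ • T (v i) := by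
  conv_lhs => rw [← v.sum_repr' x]
  simp

lemma inner_map_map_eq_sum (v : OrthonormalBasis ι ℝ E) (T : E →ₗ[ℝ] F) (x y : E) :
    ⟪T x, T y⟫_ℝ = ∑ i, ∑ j, ⟪v i, x⟫_ℝ * ⟪v j, y⟫_ℝ * ⟪T (v i), T (v j)⟫_ℝ := by
  rw [map_eq_sum_inner_smul v T x, map_eq_sum_inner_smul v T y, sum_inner]
  refine Finset.sum_congr rfl fun i _ => ?_
  rw [inner_sum]
  refine Finset.sum_congr rfl fun j _ => ?_
  rw [real_inner_smul_left, real_inner_smul_right]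
  ring

lemma norm_map_sq_eq_sum {v : OrthonormalBasis ι ℝ E} {T : E →ₗ[ℝ] F}
    (hv : ∀ i j, i ≠ j → ⟪T (v i), T (v j)⟫_ℝ = 0) (x : E) :
    ‖T x‖ ^ 2 = ∑ i, ‖T (v i)‖ ^ 2 * ⟪v i, x⟫_ℝ ^ 2 := by
  rw [← real_inner_self_eq_norm_sq, inner_map_map_eq_sum v]
  refine Finset.sum_congr rfl fun i _ => ?_
  rw [Finset.sum_eq_single i (fun j _ hj => by rw [hv i j hj.symm, mul_zero]) (by simp),
    real_inner_self_eq_norm_sq]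
  ring

/-- A right singular vector with nonzero singular value is orthogonal to the kernel. -/
lemma mem_ker_orthogonal {v : OrthonormalBasis ι ℝ E} {T : E →ₗ[ℝ] F}
    (hv : ∀ i j, i ≠ j → ⟪T (v i), T (v j)⟫_ℝ = 0) {i : ι} (hi : T (v i) ≠ 0) :
    v i ∈ T.kerᗮ := by
  rw [Submodule.mem_orthogonal']
  intro u hu
  have h := norm_map_sq_eq_sum hv u
  rw [LinearMap.mem_ker.mp hu, norm_zero, zero_pow two_ne_zero, eq_comm,
    Finset.sum_eq_zero_iff_of_nonneg fun _ _ => by positivity] at h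
  simpa [hi] using h i (Finset.mem_univ i)

lemma enorm_sq_eq_sum (v : OrthonormalBasis ι ℝ E) (x : E) :
    ‖x‖ₑ ^ 2 = ∑ i, ‖⟪v i, x⟫_ℝ‖ₑ ^ 2 := by
  simp only [← ofReal_norm, ← ENNReal.ofReal_pow (norm_nonneg _)]
  rw [← ENNReal.ofReal_sum_of_nonneg fun _ _ => by positivity, v.sum_sq_norm_inner_right]

lemma enorm_map_sq_eq_sum {v : OrthonormalBasis ι ℝ E} {T : E →ₗ[ℝ] F}
    (hv : ∀ i j, i ≠ j → ⟪T (v i), T (v j)⟫_ℝ = 0) (x : E) :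
    ‖T x‖ₑ ^ 2 = ∑ i, ‖T (v i)‖ₑ ^ 2 * ‖⟪v i, x⟫_ℝ‖ₑ ^ 2 := by
  simp only [← ofReal_norm, ← ENNReal.ofReal_pow (norm_nonneg _)]
  simp_rw [← ENNReal.ofReal_mul (sq_nonneg _)]
  rw [← ENNReal.ofReal_sum_of_nonneg fun _ _ => by positivity, norm_map_sq_eq_sum hv]
  simp

end Linear

/-! ### Second moments under an isotropic law. -/

section Moments

variable {E F ι : Type*} [NormedAddCommGroup E] [InnerProductSpace ℝ E] [MeasurableSpace E]
  [NormedAddCommGroup F] [InnerProductSpace ℝ F] [Fintype ι]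

/-- The second-moment matrix of `P` is the identity. -/
def Isotropic (P : Measure E) : Prop :=
  ∀ a b : E, ∫ x, ⟪a, x⟫_ℝ * ⟪b, x⟫_ℝ ∂P = ⟪a, b⟫_ℝ

lemma integrable_inner_mul_inner {P : Measure E} (hP : MemLp (fun x : E => x) 2 P) (a b : E) :
    Integrable (fun x => ⟪a, x⟫_ℝ * ⟪b, x⟫_ℝ) P :=
  (hP.const_inner a).integrable_mul (hP.const_inner b)

/-- Isotropy turns the mean square into the squared Hilbert–Schmidt norm. The basis need not be
singular for `T`, so the formula also applies to a perturbed map in the singular basis of the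
unperturbed one. -/
lemma lintegral_enorm_map_sq {P : Measure E} (hP : MemLp (fun x : E => x) 2 P)
    (hI : Isotropic P) (v : OrthonormalBasis ι ℝ E) (T : E →ₗ[ℝ] F) :
    ∫⁻ x, ‖T x‖ₑ ^ 2 ∂P = ENNReal.ofReal (∑ i, ‖T (v i)‖ ^ 2) := by
  have key : ∀ x, ‖T x‖ ^ 2 =
      ∑ i, ∑ j, ⟪v i, x⟫_ℝ * ⟪v j, x⟫_ℝ * ⟪T (v i), T (v j)⟫_ℝ := fun x => by
    rw [← inner_map_map_eq_sum v, real_inner_self_eq_norm_sq]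
  have hint : ∀ i j, Integrable
      (fun x => ⟪v i, x⟫_ℝ * ⟪v j, x⟫_ℝ * ⟪T (v i), T (v j)⟫_ℝ) P :=
    fun i j => (integrable_inner_mul_inner hP _ _).mul_const _
  simp only [← ofReal_norm, ← ENNReal.ofReal_pow (norm_nonneg _)]
  rw [← ofReal_integral_eq_lintegral_ofReal _ (ae_of_all _ fun _ => by positivity)]
  · congr 1
    rw [integral_congr_ae (ae_of_all _ key)]
    rw [integral_finsetSum _ fun i _ => integrable_finsetSum _ fun j _ => hint i j]
    refine Finset.sum_congr rfl fun i _ => ?_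
    rw [integral_finsetSum _ fun j _ => hint i j, Finset.sum_eq_single i]
    · rw [integral_mul_const, hI, v.inner_eq_one, one_mul, real_inner_self_eq_norm_sq]
    · intro j _ hj
      rw [integral_mul_const, hI, v.inner_eq_zero hj.symm, zero_mul]
    · simp
  · simp only [key]
    exact integrable_finsetSum _ fun i _ => integrable_finsetSum _ fun j _ => hint i j

lemma eLpNorm_two_sq {α G : Type*} [MeasurableSpace α] [NormedAddCommGroup G] (μ : Measure α)
    (f : α → G) : eLpNorm f 2 μ ^ 2 = ∫⁻ x, ‖f x‖ₑ ^ 2 ∂μ := by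
  have h := eLpNorm_nnreal_pow_eq_lintegral (μ := μ) (f := f) (p := 2) two_ne_zero
  simpa using h

lemma eLpNorm_inner_eq_one {P : Measure E} (hP : MemLp (fun x : E => x) 2 P)
    (hI : Isotropic P) {a : E} (ha : ‖a‖ = 1) : eLpNorm (fun x => ⟪a, x⟫_ℝ) 2 P = 1 := by
  have h : eLpNorm (fun x => ⟪a, x⟫_ℝ) 2 P ^ 2 = 1 := by
    rw [eLpNorm_two_sq]
    simp only [← ofReal_norm, ← ENNReal.ofReal_pow (norm_nonneg _)]
    rw [← ofReal_integral_eq_lintegral_ofReal _ (ae_of_all _ fun _ => by positivity)]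
    · simp only [Real.norm_eq_abs, sq_abs]
      simp only [pow_two]
      rw [hI, real_inner_self_eq_norm_sq, ha]
      simp
    · simpa [pow_two] using integrable_inner_mul_inner hP a a
  rcases lt_trichotomy (eLpNorm (fun x => ⟪a, x⟫_ℝ) 2 P) 1 with h1 | h1 | h1
  · exact absurd h (pow_lt_one₀ zero_le h1 two_ne_zero).ne
  · exact h1
  · exact absurd h (one_lt_pow₀ h1 two_ne_zero).ne'

end Moments

/-- The infimum defining `W2` need not be known to be attained, so the radius is enlarged slightly.
-/
lemma exists_coupling_of_W2_le {E : Type*} [NormedAddCommGroup E] [MeasurableSpace E]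
    {P P₀ : Measure E} {ρ r : ℝ} (hP : W2 P P₀ ≤ ENNReal.ofReal ρ)
    (hr : 0 < r) (hρr : ρ < r) :
    ∃ π : Measure (E × E), π.map Prod.fst = P ∧ π.map Prod.snd = P₀ ∧
      ∫⁻ p, ‖p.1 - p.2‖ₑ ^ 2 ∂π ≤ ENNReal.ofReal (r ^ 2) := by
  have h1 := hP.trans_lt ((ENNReal.ofReal_lt_ofReal_iff hr).mpr hρr)
  rw [W2] at h1
  replace h1 := ENNReal.rpow_lt_rpow h1 (zero_lt_two (α := ℝ))
  rw [← ENNReal.rpow_mul, one_div_mul_cancel two_ne_zero, ENNReal.rpow_one] at h1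
  simp only [iInf_lt_iff] at h1
  obtain ⟨π, ⟨h, h'⟩, hπ⟩ := h1
  refine ⟨π, h, h', hπ.le.trans_eq ?_⟩
  rw [ENNReal.ofReal_pow hr.le, ← ENNReal.rpow_natCast]
  norm_num

/-! ### Worst-case mean square of a linear map over the ball. -/

section WorstCase

variable {E F ι : Type*} [NormedAddCommGroup E] [InnerProductSpace ℝ E] [MeasurableSpace E]
  [BorelSpace E] [FiniteDimensional ℝ E] [NormedAddCommGroup F] [InnerProductSpace ℝ F]
  [Fintype ι] {P₀ : Measure E} {ρ : ℝ}

/-- The law of `(G x, x)` is an admissible coupling whose cost is the integral in `hG`. -/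
lemma map_mem_ambiguityBall (hP₀ : IsProb2 P₀) {G : E →ₗ[ℝ] E}
    (hG : ∫⁻ x, ‖G x - x‖ₑ ^ 2 ∂P₀ ≤ ENNReal.ofReal ρ ^ 2) :
    P₀.map G ∈ ambiguityBall P₀ ρ := by
  have hc : Continuous G := G.continuous_of_finiteDimensional
  have hm : Measurable G := hc.measurable
  have := hP₀.1
  refine ⟨⟨Measure.isProbabilityMeasure_map hm.aemeasurable, ?_⟩, ?_⟩
  · refine (memLp_map_measure_iff aestronglyMeasurable_id hm.aemeasurable).mpr ?_
    exact (LinearMap.toContinuousLinearMap G).comp_memLp' hP₀.2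
  · have hp : Measurable fun x => (G x, x) := hm.prodMk measurable_id
    have hinf : ⨅ (π : Measure (E × E)) (_ : π.map Prod.fst = P₀.map G ∧ π.map Prod.snd = P₀),
        ∫⁻ p, ‖p.1 - p.2‖ₑ ^ 2 ∂π ≤ ENNReal.ofReal ρ ^ 2 := by
      refine (iInf₂_le (P₀.map fun x => (G x, x)) ⟨?_, ?_⟩).trans ?_
      · rwa [lintegral_map (by fun_prop) hp]
      · rw [Measure.map_map measurable_fst hp]; rfl
      · rw [Measure.map_map measurable_snd hp]; exact Measure.map_id
    refine (ENNReal.rpow_le_rpow hinf (by norm_num)).trans_eq ?_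
    rw [← ENNReal.rpow_natCast, ← ENNReal.rpow_mul]
    norm_num

/-- Stretching the nominal distribution along an orthonormal basis bounds the worst-case
mean square from below. -/
lemma le_iSup_of_stretch (hP₀ : IsProb2 P₀) (hI : Isotropic P₀) (hρ : 0 ≤ ρ)
    (v : OrthonormalBasis ι ℝ E) (T : E →ₗ[ℝ] F) {j : ι → ℝ} (hj : ∑ i, j i ^ 2 ≤ ρ ^ 2) :
    ENNReal.ofReal (∑ i, (1 + j i) ^ 2 * ‖T (v i)‖ ^ 2) ≤
      ⨆ P ∈ ambiguityBall P₀ ρ, ∫⁻ ξ, ‖T ξ‖ₑ ^ 2 ∂P := by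
  let G : E →ₗ[ℝ] E := v.toBasis.constr ℝ fun i => (1 + j i) • v i
  have hG : ∀ i, G (v i) = (1 + j i) • v i := fun i => by
    simpa [G] using v.toBasis.constr_basis ℝ (fun i => (1 + j i) • v i) i
  have hGm : Measurable G := G.continuous_of_finiteDimensional.measurable
  have hTc : Continuous T := T.continuous_of_finiteDimensional
  have hmem : P₀.map G ∈ ambiguityBall P₀ ρ := by
    refine map_mem_ambiguityBall hP₀ ?_
    have h := lintegral_enorm_map_sq hP₀.2 hI v (G - LinearMap.id)
    simp only [LinearMap.sub_apply, LinearMap.id_apply, hG, add_smul, one_smul,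
      add_sub_cancel_left, norm_smul, v.norm_eq_one, mul_one, Real.norm_eq_abs, sq_abs] at h
    rw [h, ← ENNReal.ofReal_pow hρ]
    exact ENNReal.ofReal_le_ofReal hj
  refine le_trans (le_of_eq ?_) (le_iSup₂ (P₀.map G) hmem)
  rw [lintegral_map (hTc.enorm.measurable.pow_const 2) hGm]
  have h := lintegral_enorm_map_sq hP₀.2 hI v (T ∘ₗ G)
  simp only [LinearMap.comp_apply, hG, map_smul, norm_smul, mul_pow, Real.norm_eq_abs,
    sq_abs] at h
  exact h.symm

/-- Take `j i` to be the `L²` norm of the displacement along `v i`. Parseval bounds the total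
budget, and Minkowski bounds the `i`-th coordinate of the perturbed vector by `1 + j i`, its nominal
norm being `1`. Orthogonality of the `T (v i)` makes the mean square a sum over coordinates. -/
lemma exists_stretch_of_coupling (hP₀ : IsProb2 P₀) (hI : Isotropic P₀)
    {v : OrthonormalBasis ι ℝ E} {T : E →ₗ[ℝ] F}
    (hv : ∀ i j, i ≠ j → ⟪T (v i), T (v j)⟫_ℝ = 0) {P : Measure E} {π : Measure (E × E)}
    (hfst : π.map Prod.fst = P) (hsnd : π.map Prod.snd = P₀) {r : ℝ}
    (hπ : ∫⁻ p, ‖p.1 - p.2‖ₑ ^ 2 ∂π ≤ ENNReal.ofReal (r ^ 2)) :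
    ∃ j : ι → ℝ, (∀ i, 0 ≤ j i) ∧ ∑ i, j i ^ 2 ≤ r ^ 2 ∧
      ∫⁻ ξ, ‖T ξ‖ₑ ^ 2 ∂P ≤ ENNReal.ofReal (∑ i, (1 + j i) ^ 2 * ‖T (v i)‖ ^ 2) := by
  have hTc : Continuous T := T.continuous_of_finiteDimensional
  set a : ι → ℝ≥0∞ := fun i => eLpNorm (fun p : E × E => ⟪v i, p.1 - p.2⟫_ℝ) 2 π with ha
  have hsum : ∑ i, a i ^ 2 ≤ ENNReal.ofReal (r ^ 2) := by
    refine le_trans (le_of_eq ?_) hπ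
    simp only [ha, eLpNorm_two_sq]
    rw [← lintegral_finsetSum _ fun i _ => by fun_prop]
    exact lintegral_congr fun p => (enorm_sq_eq_sum v _).symm
  have hfin : ∀ i, a i ≠ ∞ := fun i hi => by
    have h := (Finset.single_le_sum (f := fun i => a i ^ 2) (fun _ _ => zero_le)
      (Finset.mem_univ i)).trans hsum
    simp [hi] at h
  have hmink : ∀ i, eLpNorm (fun p : E × E => ⟪v i, p.1⟫_ℝ) 2 π ≤ 1 + a i := fun i => by
    have h0 : eLpNorm (fun p : E × E => ⟪v i, p.2⟫_ℝ) 2 π = 1 := by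
      rw [← eLpNorm_inner_eq_one hP₀.2 hI (v.norm_eq_one i), ← hsnd,
        eLpNorm_map_measure (by fun_prop) (by fun_prop)]
      rfl
    rw [← h0]
    refine le_trans (le_of_eq ?_) (eLpNorm_add_le (by fun_prop) (by fun_prop) one_le_two)
    congr 1
    ext p
    simp [inner_sub_right]
  refine ⟨fun i => (a i).toReal, fun i => ENNReal.toReal_nonneg, ?_, ?_⟩
  · rw [← ENNReal.ofReal_le_ofReal_iff (sq_nonneg r)]
    refine le_trans (le_of_eq ?_) hsum
    rw [ENNReal.ofReal_sum_of_nonneg fun _ _ => by positivity]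
    refine Finset.sum_congr rfl fun i _ => ?_
    rw [ENNReal.ofReal_pow ENNReal.toReal_nonneg, ENNReal.ofReal_toReal (hfin i)]
  · rw [← hfst, lintegral_map (hTc.enorm.measurable.pow_const 2) measurable_fst]
    rw [lintegral_congr fun p : E × E => enorm_map_sq_eq_sum hv p.1, lintegral_finsetSum _ fun i _ => by fun_prop,
      ENNReal.ofReal_sum_of_nonneg fun _ _ => by positivity]
    refine Finset.sum_le_sum fun i _ => ?_
    rw [lintegral_const_mul _ (by fun_prop), ← eLpNorm_two_sq, mul_comm,
      ENNReal.ofReal_mul (sq_nonneg _), ENNReal.ofReal_pow (by positivity),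
      ENNReal.ofReal_pow (norm_nonneg _), ofReal_norm,
      ENNReal.ofReal_add zero_le_one ENNReal.toReal_nonneg, ENNReal.ofReal_toReal (hfin i),
      ENNReal.ofReal_one]
    gcongr
    exact hmink i

/-- Needed for uniqueness, where the optimal value is cancelled in `ℝ≥0∞`. -/
lemma iSup_lintegral_lt_top [FiniteDimensional ℝ F] (hP₀ : IsProb2 P₀) (hI : Isotropic P₀)
    (hρ : 0 ≤ ρ) (T : E →ₗ[ℝ] F) :
    ⨆ P ∈ ambiguityBall P₀ ρ, ∫⁻ ξ, ‖T ξ‖ₑ ^ 2 ∂P < ∞ := by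
  obtain ⟨v, hv⟩ := exists_orthonormalBasis_inner_map_eq_zero T
  refine lt_of_le_of_lt (iSup₂_le fun P hP => ?_)
    (ENNReal.ofReal_lt_top (r := ∑ i, (1 + (ρ + 1)) ^ 2 * ‖T (v i)‖ ^ 2))
  obtain ⟨π, h, h', hπ⟩ := exists_coupling_of_W2_le hP.2 (r := ρ + 1) (by linarith) (by linarith)
  obtain ⟨j, hj, hjr, hle⟩ := exists_stretch_of_coupling hP₀ hI hv h h' hπ
  refine hle.trans (ENNReal.ofReal_le_ofReal (Finset.sum_le_sum fun i _ => ?_))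
  have hji : j i ≤ ρ + 1 := abs_le_of_sq_le_sq' ((Finset.single_le_sum
    (f := fun i => j i ^ 2) (fun _ _ => sq_nonneg _) (Finset.mem_univ i)).trans hjr)
    (by linarith) |>.2
  have := hj i
  gcongr

/-- Perturbing `T` by a map that vanishes on the orthogonal complement of the kernel of `T`
increases the worst-case mean square by at least the squared Hilbert–Schmidt norm of the
perturbation. -/
lemma exists_iSup_add_le [FiniteDimensional ℝ F] (hP₀ : IsProb2 P₀) (hI : Isotropic P₀)
    (hρ : 0 ≤ ρ) {T R : E →ₗ[ℝ] F} (hR : T.kerᗮ ≤ R.ker) :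
    ∃ v : OrthonormalBasis (Fin (Module.finrank ℝ E)) ℝ E,
      (⨆ P ∈ ambiguityBall P₀ ρ, ∫⁻ ξ, ‖T ξ‖ₑ ^ 2 ∂P) + ENNReal.ofReal (∑ i, ‖R (v i)‖ ^ 2) ≤
        ⨆ P ∈ ambiguityBall P₀ ρ, ∫⁻ ξ, ‖(T + R) ξ‖ₑ ^ 2 ∂P := by
  classical
  obtain ⟨v, hv⟩ := exists_orthonormalBasis_inner_map_eq_zero T
  refine ⟨v, ?_⟩
  set M := ∑ i, ‖T (v i)‖ ^ 2 with hM
  have hM0 : 0 ≤ M := Finset.sum_nonneg fun _ _ => sq_nonneg _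
  refine ENNReal.le_of_forall_pos_le_add fun δ hδ _ => ?_
  have hne : (ambiguityBall P₀ ρ).Nonempty :=
    ⟨_, map_mem_ambiguityBall hP₀ (G := LinearMap.id) (by simp)⟩
  rw [ENNReal.biSup_add hne]
  refine iSup₂_le fun P hP => ?_
  -- `ε` is the excess radius of the coupling; `ε * (3 + 2 * ρ) * M` will bound the loss from
  -- scaling the stretch back to radius `ρ`.
  obtain ⟨ε, hε0, hε1, hε⟩ : ∃ ε : ℝ, 0 < ε ∧ ε ≤ 1 ∧ ε * (3 + 2 * ρ) * M ≤ δ := by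
    have hq : 0 < (3 + 2 * ρ) * M + 1 := by positivity
    refine ⟨min 1 (δ / ((3 + 2 * ρ) * M + 1)), by positivity, min_le_left _ _, ?_⟩
    calc min 1 (δ / ((3 + 2 * ρ) * M + 1)) * (3 + 2 * ρ) * M
        ≤ δ / ((3 + 2 * ρ) * M + 1) * ((3 + 2 * ρ) * M + 1) := by
          rw [mul_assoc]
          gcongr
          · exact min_le_right _ _
          · linarith
      _ = δ := div_mul_cancel₀ _ hq.ne'
  obtain ⟨π, h, h', hπ⟩ := exists_coupling_of_W2_le hP.2 (r := ρ + ε) (by linarith) (by linarith)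
  obtain ⟨j, hj, hjr, hle⟩ := exists_stretch_of_coupling hP₀ hI hv h h' hπ
  have hr : 0 < ρ + ε := by linarith
  have hjle : ∀ i, j i ≤ ρ + ε := fun i => (abs_le_of_sq_le_sq' ((Finset.single_le_sum
    (f := fun i => j i ^ 2) (fun _ _ => sq_nonneg _) (Finset.mem_univ i)).trans hjr) hr.le).2
  -- Scaling by `ρ / (ρ + ε)` restores the budget `ρ`; no stretch is spent on kernel directions of
  -- `T`.
  set k : Fin (Module.finrank ℝ E) → ℝ :=
    fun i => if T (v i) = 0 then 0 else ρ / (ρ + ε) * j i with hk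
  have hkr : ∑ i, k i ^ 2 ≤ ρ ^ 2 := by
    calc ∑ i, k i ^ 2 ≤ ∑ i, (ρ / (ρ + ε)) ^ 2 * j i ^ 2 := Finset.sum_le_sum fun i _ => by
          rw [← mul_pow]
          by_cases hi : T (v i) = 0
          · simp only [hk, if_pos hi, zero_pow two_ne_zero]
            positivity
          · simp only [hk, if_neg hi, le_refl]
      _ ≤ (ρ / (ρ + ε)) ^ 2 * (ρ + ε) ^ 2 := by rw [← Finset.mul_sum]; gcongr
      _ = ρ ^ 2 := by field_simp
  have hlow := le_iSup_of_stretch hP₀ hI hρ v (T + R) hkr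
  have hterm : ∀ i, (1 + j i) ^ 2 * ‖T (v i)‖ ^ 2 + ‖R (v i)‖ ^ 2 ≤
      (1 + k i) ^ 2 * ‖(T + R) (v i)‖ ^ 2 + ε * (3 + 2 * ρ) * ‖T (v i)‖ ^ 2 := fun i => by
    -- On `ker T` only `R` contributes; off it `v i` is orthogonal to `ker T`, so `R` vanishes and
    -- only the scaling loss remains.
    by_cases hi : T (v i) = 0
    · simp [hk, hi]
    · have hRi : R (v i) = 0 := hR (mem_ker_orthogonal hv hi)
      have hki : k i = ρ / (ρ + ε) * j i := if_neg hi
      have hkρ : k i ≤ ρ := by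
        calc k i ≤ ρ / (ρ + ε) * (ρ + ε) := by rw [hki]; gcongr; exact hjle i
          _ = ρ := div_mul_cancel₀ _ hr.ne'
      have hjk : j i - k i ≤ ε := by
        calc j i - k i = ε / (ρ + ε) * j i := by rw [hki]; field_simp; ring
          _ ≤ ε / (ρ + ε) * (ρ + ε) := by gcongr; exact hjle i
          _ = ε := div_mul_cancel₀ _ hr.ne'
      have hk0 : 0 ≤ k i := by rw [hki]; have := hj i; positivity
      have hsq : (1 + j i) ^ 2 ≤ (1 + k i) ^ 2 + ε * (3 + 2 * ρ) := by
        -- Difference of squares, with `j i ≤ ρ + ε`, `k i ≤ ρ` and `ε ≤ 1`.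
        have : (j i - k i) * (2 + j i + k i) ≤ ε * (3 + 2 * ρ) :=
          mul_le_mul hjk (by linarith [hjle i]) (by linarith [hj i]) hε0.le
        linarith
      rw [LinearMap.add_apply, hRi, add_zero, norm_zero, zero_pow two_ne_zero, add_zero,
        ← add_mul]
      gcongr
  calc ∫⁻ ξ, ‖T ξ‖ₑ ^ 2 ∂P + ENNReal.ofReal (∑ i, ‖R (v i)‖ ^ 2)
      ≤ ENNReal.ofReal (∑ i, (1 + j i) ^ 2 * ‖T (v i)‖ ^ 2) +
          ENNReal.ofReal (∑ i, ‖R (v i)‖ ^ 2) := by gcongr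
    _ = ENNReal.ofReal (∑ i, ((1 + j i) ^ 2 * ‖T (v i)‖ ^ 2 + ‖R (v i)‖ ^ 2)) := by
        rw [Finset.sum_add_distrib, ENNReal.ofReal_add] <;>
          exact Finset.sum_nonneg fun _ _ => by positivity
    _ ≤ ENNReal.ofReal (∑ i, (1 + k i) ^ 2 * ‖(T + R) (v i)‖ ^ 2 + ε * (3 + 2 * ρ) * M) := by
        refine ENNReal.ofReal_le_ofReal ?_
        rw [hM, Finset.mul_sum, ← Finset.sum_add_distrib]
        exact Finset.sum_le_sum fun i _ => hterm i
    _ ≤ ENNReal.ofReal (∑ i, (1 + k i) ^ 2 * ‖(T + R) (v i)‖ ^ 2) + δ := by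
        refine ENNReal.ofReal_add_le.trans ?_
        gcongr
        exact ENNReal.ofReal_le_of_le_toReal hε
    _ ≤ _ := by gcongr

end WorstCase

lemma isotropic_of_secondMoment_eq_one {ι : Type*} [Fintype ι] [DecidableEq ι]
    {P : Measure (EuclideanSpace ℝ ι)} (hP : IsProb2 P) (h : secondMoment P = 1) :
    Isotropic P := by
  intro a b
  have hm : ∀ i j, ∫ x, x i * x j ∂P = (1 : Matrix ι ι ℝ) i j := fun i j =>
    congrFun (congrFun h i) j
  have hint : ∀ i j, Integrable (fun x : EuclideanSpace ℝ ι => x i * x j) P := fun i j => by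
    simpa [EuclideanSpace.inner_single_left] using
      integrable_inner_mul_inner hP.2 (EuclideanSpace.single i (1 : ℝ)) (EuclideanSpace.single j 1)
  have key : ∀ x : EuclideanSpace ℝ ι, ⟪a, x⟫_ℝ * ⟪b, x⟫_ℝ =
      ∑ i, ∑ j, a i * b j * (x i * x j) := fun x => by
    simp only [PiLp.inner_apply, RCLike.inner_apply, conj_trivial, Finset.sum_mul_sum]
    exact Finset.sum_congr rfl fun i _ => Finset.sum_congr rfl fun j _ => by ring
  simp only [key]
  rw [integral_finsetSum _ fun i _ => integrable_finsetSum _ fun j _ => (hint i j).const_mul _]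
  simp only [PiLp.inner_apply, RCLike.inner_apply, conj_trivial]
  refine Finset.sum_congr rfl fun i _ => ?_
  rw [integral_finsetSum _ fun j _ => (hint i j).const_mul _]
  simp [integral_const_mul, hm, Matrix.one_apply, mul_comm]

/-! ### The estimation error and the normal equations. -/

variable {dx dw dy ds T : ℕ}

/-- The estimation error as a linear map of the disturbance. -/
def errorMap (H : Matrix (SigIdx dy T) (ProcIdx dx dw T) ℝ)
    (L : Matrix (SigIdx ds T) (ProcIdx dx dw T) ℝ) (K : Matrix (SigIdx ds T) (SigIdx dy T) ℝ) :
    Disturbance dx dw dy T →ₗ[ℝ] EuclideanSpace ℝ (SigIdx ds T) :=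
  (WithLp.linearEquiv 2 ℝ (SigIdx ds T → ℝ)).symm.toLinearMap ∘ₗ
    (Matrix.mulVecLin (Matrix.fromCols (K * H - L) K)) ∘ₗ
      (WithLp.linearEquiv 2 ℝ (ProcIdx dx dw T ⊕ SigIdx dy T → ℝ)).toLinearMap

lemma errorMap_apply (H : Matrix (SigIdx dy T) (ProcIdx dx dw T) ℝ)
    (L : Matrix (SigIdx ds T) (ProcIdx dx dw T) ℝ) (K : Matrix (SigIdx ds T) (SigIdx dy T) ℝ)
    (ξ : Disturbance dx dw dy T) : errorMap H L K ξ = estError H L K ξ := by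
  simp only [errorMap, LinearMap.comp_apply, LinearEquiv.coe_coe, WithLp.linearEquiv_apply,
    Matrix.mulVecLin_apply, Matrix.fromCols_mulVec, estError, measurement, target,
    Matrix.mulVec_add, Matrix.sub_mulVec, ← Matrix.mulVec_mulVec, WithLp.linearEquiv_symm_apply]
  refine congrArg (WithLp.toLp 2) ?_
  rw [add_sub_right_comm]
  rfl

/-- The target cancels in the difference; target matrix `0` leaves `K - K₀` applied to the
measurement. -/
lemma errorMap_eq_add (H : Matrix (SigIdx dy T) (ProcIdx dx dw T) ℝ)
    (L : Matrix (SigIdx ds T) (ProcIdx dx dw T) ℝ) (K K₀ : Matrix (SigIdx ds T) (SigIdx dy T) ℝ) :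
    errorMap H L K = errorMap H L K₀ + errorMap H 0 (K - K₀) := by
  ext1 ξ
  simp only [LinearMap.add_apply, errorMap_apply, estError, target, ← WithLp.toLp_add,
    Matrix.sub_mulVec, Matrix.zero_mulVec]
  congr 1
  abel

/-- The normal equations; `1 + H * Hᵀ` is positive definite, so the inverse is genuine. -/
lemma nonCausalEstimator_mul (H : Matrix (SigIdx dy T) (ProcIdx dx dw T) ℝ)
    (L : Matrix (SigIdx ds T) (ProcIdx dx dw T) ℝ) :
    nonCausalEstimator H L * (1 + H * Hᵀ) = L * Hᵀ := by
  have hpos : (1 + H * Hᵀ).PosDef := by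
    have h := Matrix.posSemidef_self_mul_conjTranspose H
    rw [Matrix.conjTranspose_eq_transpose_of_trivial] at h
    exact Matrix.PosDef.one.add_posSemidef h
  exact Matrix.nonsing_inv_mul_cancel_right _ _ ((Matrix.isUnit_iff_isUnit_det _).mp hpos.isUnit)

lemma errorMap_ker_orthogonal_le (H : Matrix (SigIdx dy T) (ProcIdx dx dw T) ℝ)
    (L : Matrix (SigIdx ds T) (ProcIdx dx dw T) ℝ) (D : Matrix (SigIdx ds T) (SigIdx dy T) ℝ) :
    (errorMap H L (nonCausalEstimator H L)).kerᗮ ≤ (errorMap H 0 D).ker := by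
  intro v hv
  rw [Submodule.mem_orthogonal] at hv
  set y := measurement H v with hy
  -- The adjoint of the measurement map applied to `y`: the estimator makes no error on `u`, while
  -- `⟪u, v⟫ = ‖y‖²`, so orthogonality forces `y = 0`.
  let u : Disturbance dx dw dy T := WithLp.toLp 2 (Sum.elim (Hᵀ *ᵥ y) y)
  have hu : u ∈ (errorMap H L (nonCausalEstimator H L)).ker := by
    have h : measurement H u = (1 + H * Hᵀ) *ᵥ y := by
      simp only [measurement, u, Sum.elim_inl, Sum.elim_inr, Matrix.add_mulVec,
        Matrix.one_mulVec, ← Matrix.mulVec_mulVec]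
      exact add_comm _ _
    rw [LinearMap.mem_ker, errorMap_apply, estError, h, Matrix.mulVec_mulVec,
      nonCausalEstimator_mul, ← Matrix.mulVec_mulVec]
    simp [target, u]
  have hinner : ⟪u, v⟫_ℝ = y ⬝ᵥ y := by
    have h : ⟪u, v⟫_ℝ = (Hᵀ *ᵥ y) ⬝ᵥ (fun j => v (Sum.inl j)) + y ⬝ᵥ fun i => v (Sum.inr i) := by
      simp [PiLp.inner_apply, u, dotProduct, mul_comm]
    rw [h, Matrix.mulVec_transpose, ← Matrix.dotProduct_mulVec, ← dotProduct_add]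
    rfl
  have hy0 : y = 0 := dotProduct_self_eq_zero.mp (hinner.symm.trans (hv u hu))
  rw [LinearMap.mem_ker, errorMap_apply, estError, ← hy, hy0]
  simp [target]

lemma eq_zero_of_errorMap_eq_zero {H : Matrix (SigIdx dy T) (ProcIdx dx dw T) ℝ}
    {D : Matrix (SigIdx ds T) (SigIdx dy T) ℝ} (h : errorMap H 0 D = 0) : D = 0 := by
  refine Matrix.mulVec_injective (funext fun y => ?_)
  -- Measurement noise alone, with zero process noise, produces every `y`.
  have h1 := LinearMap.congr_fun h (WithLp.toLp 2 (Sum.elim 0 y))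
  rw [errorMap_apply] at h1
  have h2 := congrArg WithLp.ofLp h1
  simpa [estError, target, measurement, ← Pi.zero_def] using h2

lemma worstCaseMSE_eq (H : Matrix (SigIdx dy T) (ProcIdx dx dw T) ℝ)
    (L : Matrix (SigIdx ds T) (ProcIdx dx dw T) ℝ) (P₀ : Measure (Disturbance dx dw dy T)) (ρ : ℝ)
    (K : Matrix (SigIdx ds T) (SigIdx dy T) ℝ) :
    worstCaseMSE H L P₀ ρ K = ⨆ P ∈ ambiguityBall P₀ ρ, ∫⁻ ξ, ‖errorMap H L K ξ‖ₑ ^ 2 ∂P := by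
  simp only [worstCaseMSE, errorMap_apply]

/-- For an isotropic nominal distribution, the nominal non-causal estimator is the unique
minimizer of the worst-case mean-squared error. -/
theorem worstCaseMSE_minimizer_iff (H : Matrix (SigIdx dy T) (ProcIdx dx dw T) ℝ)
    (L : Matrix (SigIdx ds T) (ProcIdx dx dw T) ℝ) {P₀ : Measure (Disturbance dx dw dy T)}
    (hP₀ : IsProb2 P₀) (hcov : secondMoment P₀ = 1) {ρ : ℝ} (hρ : 0 ≤ ρ)
    (K : Matrix (SigIdx ds T) (SigIdx dy T) ℝ) :
    (∀ K', worstCaseMSE H L P₀ ρ K ≤ worstCaseMSE H L P₀ ρ K') ↔ K = nonCausalEstimator H L := by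
  have hI := isotropic_of_secondMoment_eq_one hP₀ hcov
  have key := fun K' => exists_iSup_add_le hP₀ hI hρ
    (errorMap_ker_orthogonal_le H L (K' - nonCausalEstimator H L))
  simp only [← errorMap_eq_add, ← worstCaseMSE_eq] at key
  constructor
  · intro hK
    obtain ⟨v, hv⟩ := key K
    have hfin : worstCaseMSE H L P₀ ρ (nonCausalEstimator H L) ≠ ∞ := by
      rw [worstCaseMSE_eq]
      exact (iSup_lintegral_lt_top hP₀ hI hρ _).ne
    have h0 := (ENNReal.add_le_add_iff_left hfin).mp
      ((hv.trans (hK (nonCausalEstimator H L))).trans_eq (add_zero _).symm)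
    rw [nonpos_iff_eq_zero, ENNReal.ofReal_eq_zero] at h0
    have h1 := (Finset.sum_eq_zero_iff_of_nonneg fun _ _ => sq_nonneg _).mp
      (h0.antisymm (Finset.sum_nonneg fun _ _ => sq_nonneg _))
    refine sub_eq_zero.mp (eq_zero_of_errorMap_eq_zero (H := H) (v.toBasis.ext fun i => ?_))
    simpa using h1 i (Finset.mem_univ i)
  · rintro rfl K'
    obtain ⟨v, hv⟩ := key K'
    exact le_self_add.trans hv

end DRKF

theorem lemma3p3 {dx dw dy ds T : ℕ} (hT : 0 < T)
    (A : Matrix (Fin dx) (Fin dx) ℝ) (B : Matrix (Fin dx) (Fin dw) ℝ)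
    (Cy : Matrix (Fin dy) (Fin dx) ℝ) (Cs : Matrix (Fin ds) (Fin dx) ℝ)
    (P₀ : Measure (DRKF.Disturbance dx dw dy T)) (hP₀ : DRKF.IsProb2 P₀)
    (hcov : DRKF.secondMoment P₀ = 1) (ρ : ℝ) (hρ : 0 ≤ ρ)
    (K : Matrix (DRKF.SigIdx ds T) (DRKF.SigIdx dy T) ℝ) :
    (∀ K' : Matrix (DRKF.SigIdx ds T) (DRKF.SigIdx dy T) ℝ,
      DRKF.worstCaseMSE (DRKF.outputMatrix A B Cy T) (DRKF.outputMatrix A B Cs T) P₀ ρ K ≤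
        DRKF.worstCaseMSE (DRKF.outputMatrix A B Cy T) (DRKF.outputMatrix A B Cs T) P₀ ρ K') ↔
      K = DRKF.nonCausalEstimator (DRKF.outputMatrix A B Cy T) (DRKF.outputMatrix A B Cs T) := by
  exact DRKF.worstCaseMSE_minimizer_iff _ _ hP₀ hcov hρ K
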